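/- Let $T$ be a tree (a connected graph without cycles) with countable vertex set, also denoted by $T$, in which every vertex has finitely many neighbours. Fix a reference vertex $x_0$, and for a vertex $x$ let $S(x)$ be the set of its children, i.e. of the neighbours of $x$ that do not lie on the geodesic from $x_0$ to $x$; for $x\neq x_0$ the remaining neighbour is the parent $x^-$ of $x$. Assume that every $S(x)$ has at least two elements. Let real weights $q(x,y)$ be given for neighbouring vertices $x,y$, with $q(x,x^-)=0$ for $x\ne x_0$, $q(x,y)>0$ for all $y\in S(x)$, and $\sum_{y\in S(x)}q(x,y)=1$ for every $x$. The boundary $\partial T$ is the set of infinite geodesics $e=(z_0,z_1,z_2,\dots)$ with $z_0=x_0$ and $z_{n+1}\in S(z_n)$ for all $n\ge 0$. It carries the $\sigma$-algebra $\mathcal M$ generated by the sectors $B_x=\{e\in\partial T: x\in e\}$, $x\in T$, and the unique probability measure $P$ on $\mathcal M$ such that $P(B_x)=\prod_{j=0}^{n-1}q(y_j,y_{j+1})$ whenever $(y_0,\dots,y_n)$ is the geodesic from $x_0$ to $x$. Let $E$ be a separable Fréchet space over $\mathbb R$ or $\mathbb C$, and let $d$ be a complete translation-invariant metric inducing its topology.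 Let $H_Q(T,E)$ be the vector space of all functions $f:T\to E$ with $f(x)=\sum_{y\in S(x)}q(x,y)f(y)$ for every $x\in T$ (the $Q$-harmonic functions), with the topology of pointwise convergence. Let $L^0(\partial T,E)$ be the space of $\mathcal M$-measurable functions $\partial T\to E$ modulo $P$-almost everywhere equality, with the metric of convergence in probability $$\widetilde\rho(h_1,h_2)=\int_{\partial T}\frac{d(h_1,h_2)}{1+d(h_1,h_2)}\,dP .$$ For $f\in H_Q(T,E)$ and $n\ge 0$ define $\omega_n(f):\partial T\to E$ by $\omega_n(f)(e)=f(z_n)$ for $e=(z_0,z_1,\dots)$. The function $f$ is called frequently universal if for every non-empty open set $V\subseteq L^0(\partial T,E)$ the set $A=\{n\ge 0:\omega_n(f)\in V\}$ has strictly positive lower density, i.e. $\liminf_{n\to\infty}\frac{1}{n+1}\,\mathrm{card}\{m\in A: m\le n\}>0$. Let $U_{FM}(T,E)$ be the set of frequently universal functions $f\in H_Q(T,E)$. Then $U_{FM}(T,E)\cup\{0\}$ contains a vector subspace of $H_Q(T,E)$ (over the scalar field of $E$) that is dense in $H_Q(T,E)$. In particular, this holds for $E=\mathbb C$. -/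

import Mathlib

open MeasureTheory ProbabilityTheory Filter Topology

universe u v

/-! ### Lower density -/

/-- The lower density `liminf card {m ∈ A : m ≤ n} / (n + 1)` of a set of natural numbers. -/
noncomputable def lowerDensity (A : Set ℕ) : ℝ :=
  liminf (fun n : ℕ => ({m | m ∈ A ∧ m ≤ n}.ncard : ℝ) / ((n : ℝ) + 1)) atTop

/-! ### The space `L⁰` with the topology of convergence in probability -/

/-- The space of (a.e. strongly) measurable functions modulo almost everywhere equality.  For a
separable metric space `E` these are the classes of the Borel measurable functions. -/
def LZero {Ω : Type u} [MeasurableSpace Ω] (P : Measure Ω) (E : Type v) [TopologicalSpace E] :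
    Type (max u v) :=
  Ω →ₘ[P] E

namespace LZero

variable {Ω : Type u} [MeasurableSpace Ω] {P : Measure Ω} {E : Type v} [MetricSpace E]

/-- The distance `∫ d(h₁, h₂) / (1 + d(h₁, h₂)) dP` of convergence in probability. -/
noncomputable def rho (h₁ h₂ : Ω →ₘ[P] E) : ℝ :=
  ∫ x, dist (h₁ x) (h₂ x) / (1 + dist (h₁ x) (h₂ x)) ∂P

theorem integrable_rho [IsFiniteMeasure P] (h₁ h₂ : Ω →ₘ[P] E) :
    Integrable (fun x => dist (h₁ x) (h₂ x) / (1 + dist (h₁ x) (h₂ x))) P := by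
  have hd : AEMeasurable (fun x => dist (h₁ x) (h₂ x)) P :=
    (h₁.aestronglyMeasurable.dist h₂.aestronglyMeasurable).aemeasurable
  refine Integrable.of_bound (hd.div (hd.const_add 1)).aestronglyMeasurable 1 ?_
  refine Eventually.of_forall fun x => ?_
  have : 0 ≤ dist (h₁ x) (h₂ x) := dist_nonneg
  rw [Real.norm_of_nonneg (by positivity), div_le_one (by positivity)]
  linarith

theorem rho_triangle_aux (x y z : E) :
    dist x z / (1 + dist x z) ≤ dist x y / (1 + dist x y) + dist y z / (1 + dist y z) := by
  have ha : 0 ≤ dist x y := dist_nonneg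
  have hb : 0 ≤ dist y z := dist_nonneg
  have hc : 0 ≤ dist x z := dist_nonneg
  have h := dist_triangle x y z
  generalize dist x y = a at *
  generalize dist y z = b at *
  generalize dist x z = c at *
  have e : ∀ t : ℝ, 0 ≤ t → t / (1 + t) = 1 - 1 / (1 + t) := fun t ht => by
    field_simp
    ring
  calc c / (1 + c) ≤ (a + b) / (1 + (a + b)) := by
        rw [e c hc, e (a + b) (by positivity)]
        gcongr
    _ = a / (1 + (a + b)) + b / (1 + (a + b)) := by rw [add_div]
    _ ≤ a / (1 + a) + b / (1 + b) := by
        gcongr <;> linarith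

theorem eq_of_rho_eq_zero [IsFiniteMeasure P] {h₁ h₂ : Ω →ₘ[P] E} (h : rho h₁ h₂ = 0) :
    h₁ = h₂ := by
  refine AEEqFun.ext ?_
  have h0 : ∫ x, dist (h₁ x) (h₂ x) / (1 + dist (h₁ x) (h₂ x)) ∂P = 0 := h
  rw [integral_eq_zero_iff_of_nonneg (fun x => by positivity) (integrable_rho h₁ h₂)] at h0
  filter_upwards [h0] with x hx
  have h1 : (1 : ℝ) + dist (h₁ x) (h₂ x) ≠ 0 := by positivity
  simpa [h1] using hx

noncomputable instance [IsFiniteMeasure P] : MetricSpace (LZero P E) where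
  dist := rho
  dist_self h := by simp [rho]
  dist_comm h₁ h₂ := by simp [rho, dist_comm]
  dist_triangle h₁ h₂ h₃ := by
    unfold rho
    rw [← integral_add (integrable_rho h₁ h₂) (integrable_rho h₂ h₃)]
    exact integral_mono (integrable_rho h₁ h₃)
      ((integrable_rho h₁ h₂).add (integrable_rho h₂ h₃)) fun x => rho_triangle_aux _ _ _
  eq_of_dist_eq_zero {h₁ h₂} h := eq_of_rho_eq_zero h

end LZero

/-! ### Trees with transition weights -/

/-- The set `S(x)` of the children of the vertex `x` in the graph `G` with reference vertex `r`:
the neighbours of `x` which are one step farther from `r` than `x`.  In a tree these are all the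
neighbours of `x` except the one on the geodesic path from `r` to `x`,
see `mem_childrenSet_iff_notMem_path`. -/
def childrenSet {V : Type u} (G : SimpleGraph V) (r x : V) : Set V :=
  {y | G.Adj x y ∧ G.dist r y = G.dist r x + 1}

/-- In a tree, `y` is a child of `x` if and only if `y` is a neighbour of `x` which does not lie
on the path from the reference vertex to `x`. -/
theorem mem_childrenSet_iff_notMem_path {V : Type u} {G : SimpleGraph V} (hG : G.IsTree)
    (r x y : V) :
    y ∈ childrenSet G r x ↔ G.Adj x y ∧ ∀ p : G.Walk r x, p.IsPath → y ∉ p.support := by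
  constructor
  · rintro ⟨hxy, hd⟩
    refine ⟨hxy, fun p hp hy => ?_⟩
    obtain ⟨p₀, hp₀, hl⟩ := hG.connected.exists_path_of_dist r x
    have : p = p₀ := (hG.existsUnique_path r x).unique hp hp₀
    subst this
    classical
    have h1 := G.dist_le (p.takeUntil y hy)
    have h2 := p.length_takeUntil_le_length hy
    omega
  · rintro ⟨hxy, h⟩
    refine ⟨hxy, ?_⟩
    obtain ⟨p, hp, hl⟩ := hG.connected.exists_path_of_dist r x
    obtain ⟨q, hq, hl'⟩ := hG.connected.exists_path_of_dist r y
    have hc : (p.concat hxy).IsPath := hp.concat (h p hp) hxy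
    have : q = p.concat hxy := (hG.existsUnique_path r y).unique hq hc
    rw [← hl', this, SimpleGraph.Walk.length_concat, hl]

/-- In a tree a vertex is a child of at most one vertex (its parent). -/
theorem childrenSet_parent_unique {V : Type u} {G : SimpleGraph V} (hG : G.IsTree)
    {r x x' y : V} (h : y ∈ childrenSet G r x) (h' : y ∈ childrenSet G r x') : x = x' := by
  obtain ⟨p, hp, -⟩ := hG.connected.exists_path_of_dist r x
  obtain ⟨p', hp', -⟩ := hG.connected.exists_path_of_dist r x'
  have hy := ((mem_childrenSet_iff_notMem_path hG r x y).1 h).2 p hp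
  have hy' := ((mem_childrenSet_iff_notMem_path hG r x' y).1 h').2 p' hp'
  have := (hG.existsUnique_path r y).unique (hp.concat hy h.1) (hp'.concat hy' h'.1)
  have := congrArg SimpleGraph.Walk.penultimate this
  simpa using this

/-- A countable, locally finite tree on the vertex set `V` with a reference vertex `root` in which
every vertex has at least two children, together with transition weights `q`: for every vertex `x`,
`q x y` is positive if `y` is a child of `x`, it is zero if `y` is the parent of `x`, and the
weights of the children of `x` sum to `1`.  (Only the values `q x y` for adjacent vertices
`x`, `y` carry information.) -/
structure WeightedTree (V : Type u) where
  graph : SimpleGraph V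
  isTree : graph.IsTree
  countable : Countable V
  finite_neighborSet : ∀ x, (graph.neighborSet x).Finite
  root : V
  two_le_children : ∀ x, 2 ≤ (childrenSet graph root x).ncard
  q : V → V → ℝ
  q_pos : ∀ x, ∀ y ∈ childrenSet graph root x, 0 < q x y
  q_parent : ∀ x y, graph.Adj x y → y ∉ childrenSet graph root x → q x y = 0
  sum_q : ∀ x, ∑ᶠ y ∈ childrenSet graph root x, q x y = 1

namespace WeightedTree

variable {V : Type u} (T : WeightedTree V)

theorem finite_childrenSet (x : V) : (childrenSet T.graph T.root x).Finite :=
  (T.finite_neighborSet x).subset fun _ hy => hy.1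

/-- The finite set `S(x)` of the children of `x`. -/
noncomputable def children (x : V) : Finset V := (T.finite_childrenSet x).toFinset

theorem mem_children {x y : V} :
    y ∈ T.children x ↔ T.graph.Adj x y ∧ T.graph.dist T.root y = T.graph.dist T.root x + 1 := by
  rw [children, Set.Finite.mem_toFinset]
  exact Iff.rfl

theorem sum_children_q (x : V) : ∑ y ∈ T.children x, T.q x y = 1 := by
  rw [← T.sum_q x, finsum_mem_eq_finite_toFinset_sum _ (T.finite_childrenSet x)]
  rfl

theorem q_pos' {x y : V} (h : y ∈ T.children x) : 0 < T.q x y :=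
  T.q_pos x y (T.mem_children.1 h)

/-! ### The boundary and its probability measure -/

/-- The boundary `∂T`: the infinite geodesics starting at the reference vertex. -/
def Boundary : Type u := {e : ℕ → V // e 0 = T.root ∧ ∀ n, e (n + 1) ∈ T.children (e n)}

variable {T} in
/-- The `n`-th vertex of a boundary point; it is the unique vertex of the geodesic at distance `n`
from the reference vertex. -/
def Boundary.vertex (e : T.Boundary) (n : ℕ) : V := e.1 n

theorem dist_vertex (e : T.Boundary) (n : ℕ) : T.graph.dist T.root (e.vertex n) = n := by
  induction n with
  | zero => simp [Boundary.vertex, e.2.1]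
  | succ n ih =>
    have h : T.graph.dist T.root (e.vertex (n + 1)) = T.graph.dist T.root (e.vertex n) + 1 :=
      (T.mem_children.1 (e.2.2 n)).2
    rw [h, ih]

theorem vertex_injective : Function.Injective (Boundary.vertex : T.Boundary → ℕ → V) :=
  Subtype.val_injective

theorem range_vertex : Set.range (Boundary.vertex : T.Boundary → ℕ → V) =
    {x : ℕ → V | x 0 = T.root ∧ ∀ n, x (n + 1) ∈ T.children (x n)} :=
  Subtype.range_val

/-- The boundary sector `B_x`: the boundary points that pass through `x`. -/
def sector (x : V) : Set T.Boundary := {e | ∃ n, e.vertex n = x}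

/-- The σ-algebra on the boundary, generated by all sectors. -/
instance : MeasurableSpace T.Boundary := MeasurableSpace.generateFrom (Set.range T.sector)

theorem sector_vertex (e : T.Boundary) (n : ℕ) :
    T.sector (e.vertex n) = {e' | e'.vertex n = e.vertex n} := by
  ext e'
  constructor
  · rintro ⟨m, hm⟩
    have h1 := T.dist_vertex e' m
    rw [hm, T.dist_vertex] at h1
    subst h1
    exact hm
  · intro h
    exact ⟨n, h⟩

theorem vertex_eq_of_le {e e' : T.Boundary} {n : ℕ} (h : e'.vertex n = e.vertex n) :
    ∀ j ≤ n, e'.vertex j = e.vertex j := by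
  induction n with
  | zero => intro j hj; obtain rfl : j = 0 := by omega
            exact h
  | succ n ih =>
    have h1 := T.mem_children.1 (e.2.2 n)
    have h2 := T.mem_children.1 (e'.2.2 n)
    have h3 : e'.1 (n + 1) = e.1 (n + 1) := h
    rw [h3] at h2
    have := ih (childrenSet_parent_unique T.isTree h2 h1)
    intro j hj
    rcases Nat.lt_or_ge j (n + 1) with hj' | hj'
    · exact this j (by omega)
    · obtain rfl : j = n + 1 := by omega
      exact h

section Law

variable [MeasurableSpace V]

/-- The law of one step of the walk from `x`: the child `y` is chosen with probability `q x y`. -/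
noncomputable def stepLaw (x : V) : Measure V :=
  ∑ y ∈ T.children x, ENNReal.ofReal (T.q x y) • Measure.dirac y

theorem isProbabilityMeasure_stepLaw (x : V) : IsProbabilityMeasure (T.stepLaw x) := by
  constructor
  simp only [stepLaw, Measure.coe_finsetSum, Finset.sum_apply, Measure.smul_apply,
    measure_univ, smul_eq_mul, mul_one]
  rw [← ENNReal.ofReal_sum_of_nonneg fun y hy => (T.q_pos' hy).le, T.sum_children_q,
    ENNReal.ofReal_one]

variable [DiscreteMeasurableSpace V]

theorem stepLaw_singleton {x y : V} (h : y ∈ T.children x) :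
    T.stepLaw x {y} = ENNReal.ofReal (T.q x y) := by
  classical
  simp only [stepLaw, Measure.coe_finsetSum, Finset.sum_apply, Measure.smul_apply,
    Measure.dirac_apply, smul_eq_mul]
  rw [Finset.sum_eq_single y]
  · simp
  · intro b _ hb
    simp [hb]
  · exact fun h' => absurd h h'

theorem stepLaw_compl (x : V) : T.stepLaw x {y | y ∉ T.children x} = 0 := by
  classical
  simp only [stepLaw, Measure.coe_finsetSum, Finset.sum_apply, Measure.smul_apply,
    Measure.dirac_apply, smul_eq_mul]
  refine Finset.sum_eq_zero fun y hy => ?_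
  simp [hy]

/-- The transition kernel of the walk, as a kernel depending on the last vertex visited. -/
noncomputable def stepKernel (n : ℕ) : Kernel ((i : Finset.Iic n) → V) V where
  toFun w := T.stepLaw (w ⟨n, Finset.mem_Iic.2 le_rfl⟩)
  measurable' :=
    (Measurable.of_discrete (f := T.stepLaw)).comp (measurable_pi_apply _)

instance (n : ℕ) : IsMarkovKernel (T.stepKernel n) :=
  ⟨fun _ => T.isProbabilityMeasure_stepLaw _⟩

/-- The law, on the space of all sequences of vertices, of the walk which starts at the reference
vertex and moves from `x` to its child `y` with probability `q x y`. -/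
noncomputable def walkLaw : Measure (ℕ → V) :=
  Kernel.trajMeasure (X := fun _ => V) (Measure.dirac T.root) T.stepKernel

instance : IsProbabilityMeasure T.walkLaw := by
  unfold walkLaw; infer_instance

theorem walkLaw_step (n : ℕ) :
    T.walkLaw.map (Preorder.frestrictLe n) ⊗ₘ T.stepKernel n =
      T.walkLaw.map (fun x => (Preorder.frestrictLe n x, x (n + 1))) :=
  Kernel.map_frestrictLe_trajMeasure_compProd_eq_map_trajMeasure

theorem walkLaw_root : T.walkLaw {x | x 0 = T.root} = 1 := by
  have h : T.walkLaw.map (Preorder.frestrictLe 0) =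
      (Measure.dirac T.root).map
        (MeasurableEquiv.piUnique (fun _ : Finset.Iic 0 => V)).symm := by
    rw [walkLaw, Kernel.trajMeasure, Measure.map_comp _ _ (by fun_prop),
      Kernel.traj_map_frestrictLe, Kernel.partialTraj_self, Measure.id_comp]
  have h0 : Measurable (Preorder.frestrictLe 0 : (ℕ → V) → (Finset.Iic 0 → V)) := by fun_prop
  have hs : MeasurableSet {w : Finset.Iic 0 → V | w ⟨0, by simp⟩ = T.root} := by
    have h2 : Measurable fun w : Finset.Iic 0 → V => w ⟨0, by simp⟩ := by fun_prop
    exact h2 (MeasurableSet.of_discrete (s := {T.root}))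
  have h1 := congrArg (fun ν => ν {w : Finset.Iic 0 → V | w ⟨0, by simp⟩ = T.root}) h
  rw [Measure.map_apply h0 hs, Measure.map_apply (MeasurableEquiv.measurable _) hs] at h1
  refine h1.trans ?_
  rw [Measure.dirac_apply_of_mem]
  rfl

theorem walkLaw_cylinder (e : T.Boundary) (n : ℕ) :
    T.walkLaw {x | ∀ j ≤ n, x j = e.vertex j} =
      ∏ j ∈ Finset.range n, ENNReal.ofReal (T.q (e.vertex j) (e.vertex (j + 1))) := by
  have hm : ∀ n, Measurable (Preorder.frestrictLe n : (ℕ → V) → (Finset.Iic n → V)) :=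
    fun n => by fun_prop
  induction n with
  | zero =>
    have : {x : ℕ → V | ∀ j ≤ 0, x j = e.vertex j} = {x | x 0 = T.root} := by
      ext x; simp [Boundary.vertex, e.2.1]
    rw [this, walkLaw_root, Finset.prod_range_zero]
  | succ n ih =>
    set w : Finset.Iic n → V := Preorder.frestrictLe n e.1 with hw
    have h1 := congrArg (fun ν => ν ({w} ×ˢ {e.vertex (n + 1)})) (T.walkLaw_step n)
    rw [Measure.compProd_apply_prod (measurableSet_singleton _) (measurableSet_singleton _),
      Measure.map_apply (by fun_prop)
        ((measurableSet_singleton _).prod (measurableSet_singleton _)),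
      lintegral_singleton, Measure.map_apply (hm n) (measurableSet_singleton _)] at h1
    have hA' : ∀ x : ℕ → V, Preorder.frestrictLe (π := fun _ => V) n x = w ↔
        ∀ j ≤ n, x j = e.vertex j := by
      intro x
      constructor
      · intro h j hj
        exact congrFun h ⟨j, Finset.mem_Iic.2 hj⟩
      · intro h
        funext j
        exact h j (Finset.mem_Iic.1 j.2)
    have hA : Preorder.frestrictLe (π := fun _ => V) n ⁻¹' ({w} : Set (Finset.Iic n → V)) =
        {x : ℕ → V | ∀ j ≤ n, x j = e.vertex j} := Set.ext hA'
    have hB : (fun x : ℕ → V => (Preorder.frestrictLe (π := fun _ => V) n x, x (n + 1))) ⁻¹'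
        (({w} : Set (Finset.Iic n → V)) ×ˢ {e.vertex (n + 1)}) =
        {x : ℕ → V | ∀ j ≤ n + 1, x j = e.vertex j} := by
      ext x
      constructor
      · rintro ⟨ha, hb⟩ j hj
        rcases Nat.lt_or_ge j (n + 1) with hj' | hj'
        · exact (hA' x).1 ha j (by omega)
        · obtain rfl : j = n + 1 := by omega
          exact hb
      · exact fun h => ⟨(hA' x).2 fun j hj => h j (by omega), h _ le_rfl⟩
    rw [hA, hB, ih] at h1
    rw [← h1, Finset.prod_range_succ, mul_comm]
    congr 1
    exact T.stepLaw_singleton (e.2.2 n)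

theorem measurableSet_range_boundary :
    MeasurableSet {x : ℕ → V | x 0 = T.root ∧ ∀ n, x (n + 1) ∈ T.children (x n)} := by
  have := T.countable
  rw [Set.ofPred_and]
  refine MeasurableSet.inter ?_ ?_
  · exact measurable_pi_apply (X := fun _ => V) 0 (MeasurableSet.of_discrete (s := {T.root}))
  · rw [show {x : ℕ → V | ∀ n, x (n + 1) ∈ T.children (x n)} =
      ⋂ n, {x : ℕ → V | x (n + 1) ∈ T.children (x n)} by ext; simp]
    refine MeasurableSet.iInter fun n => ?_
    have : Measurable fun x : ℕ → V => (x n, x (n + 1)) := by fun_prop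
    exact this (MeasurableSet.of_discrete (s := {p : V × V | p.2 ∈ T.children p.1}))

theorem walkLaw_boundary :
    T.walkLaw {x : ℕ → V | x 0 = T.root ∧ ∀ n, x (n + 1) ∈ T.children (x n)} = 1 := by
  have hc := T.countable
  rw [← mem_ae_iff_prob_eq_one T.measurableSet_range_boundary]
  have h0 : ∀ᵐ x ∂T.walkLaw, x 0 = T.root := by
    have : MeasurableSet {x : ℕ → V | x 0 = T.root} :=
      measurable_pi_apply (X := fun _ => V) 0 (MeasurableSet.of_discrete (s := {T.root}))
    exact (mem_ae_iff_prob_eq_one this).2 T.walkLaw_root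
  have h1 : ∀ n, ∀ᵐ x ∂T.walkLaw, x (n + 1) ∈ T.children (x n) := by
    intro n
    have hm : Measurable fun p : (Finset.Iic n → V) × V =>
        (p.1 ⟨n, Finset.mem_Iic.2 le_rfl⟩, p.2) := by fun_prop
    have hs : MeasurableSet {p : (Finset.Iic n → V) × V |
        p.2 ∉ T.children (p.1 ⟨n, Finset.mem_Iic.2 le_rfl⟩)} :=
      hm (MeasurableSet.of_discrete (s := {p : V × V | p.2 ∉ T.children p.1}))
    have h2 := congrArg (fun ν => ν {p : (Finset.Iic n → V) × V |
        p.2 ∉ T.children (p.1 ⟨n, Finset.mem_Iic.2 le_rfl⟩)}) (T.walkLaw_step n)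
    rw [Measure.compProd_apply hs, Measure.map_apply (by fun_prop) hs] at h2
    rw [ae_iff]
    refine Eq.trans h2.symm ?_
    refine (lintegral_congr fun w => ?_).trans lintegral_zero
    exact T.stepLaw_compl _
  filter_upwards [h0, ae_all_iff.2 h1] with x hx hx' using ⟨hx, hx'⟩

end Law

/-- The probability measure `P` on the boundary: the law of the walk, regarded as a measure on the
set of infinite geodesics.  It is the unique measure on the boundary which gives to each sector
`B_x` the product of the weights along the geodesic from the reference vertex to `x`. -/
noncomputable def boundaryMeasure : Measure T.Boundary :=
  letI : MeasurableSpace V := ⊤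
  T.walkLaw.comap Boundary.vertex

theorem measurable_vertex [MeasurableSpace V] (n : ℕ) :
    Measurable fun e : T.Boundary => e.vertex n := by
  have := T.countable
  refine measurable_to_countable fun e => ?_
  rw [show (fun e : T.Boundary => e.vertex n) ⁻¹' {e.vertex n} = T.sector (e.vertex n) from
    (T.sector_vertex e n).symm]
  exact MeasurableSpace.measurableSet_generateFrom ⟨_, rfl⟩

theorem measurableSet_image_val [MeasurableSpace V] [DiscreteMeasurableSpace V]
    {s : Set T.Boundary} (hs : MeasurableSet s) :
    MeasurableSet (Boundary.vertex '' s : Set (ℕ → V)) := by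
  have hle : (inferInstance : MeasurableSpace T.Boundary) ≤
      MeasurableSpace.comap (Boundary.vertex : T.Boundary → ℕ → V) MeasurableSpace.pi := by
    refine MeasurableSpace.generateFrom_le ?_
    rintro _ ⟨x, rfl⟩
    refine ⟨{y | ∃ n, y n = x}, ?_, rfl⟩
    rw [show {y : ℕ → V | ∃ n, y n = x} = ⋃ n, {y | y n = x} by ext; simp]
    exact MeasurableSet.iUnion fun n =>
      measurable_pi_apply (X := fun _ => V) n (MeasurableSet.of_discrete (s := {x}))
  obtain ⟨t, ht, rfl⟩ := hle s hs
  rw [Set.image_preimage_eq_inter_range, T.range_vertex]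
  exact ht.inter T.measurableSet_range_boundary

theorem boundaryMeasure_apply {s : Set T.Boundary} (hs : MeasurableSet s) :
    T.boundaryMeasure s =
      letI : MeasurableSpace V := ⊤
      T.walkLaw (Boundary.vertex '' s) := by
  let _ : MeasurableSpace V := ⊤
  exact Measure.comap_apply _ T.vertex_injective (fun t ht => T.measurableSet_image_val ht) _ hs

instance : IsProbabilityMeasure T.boundaryMeasure := by
  let _ : MeasurableSpace V := ⊤
  constructor
  rw [T.boundaryMeasure_apply MeasurableSet.univ, Set.image_univ, T.range_vertex]
  exact T.walkLaw_boundary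

/-- The measure of the sector of a vertex is the product of the weights along the geodesic from
the reference vertex to it. -/
theorem boundaryMeasure_sector (e : T.Boundary) (n : ℕ) :
    T.boundaryMeasure (T.sector (e.vertex n)) =
      ∏ j ∈ Finset.range n, ENNReal.ofReal (T.q (e.vertex j) (e.vertex (j + 1))) := by
  let _ : MeasurableSpace V := ⊤
  rw [T.boundaryMeasure_apply (MeasurableSpace.measurableSet_generateFrom ⟨_, rfl⟩),
    ← T.walkLaw_cylinder e n]
  refine measure_congr ?_
  have h := (mem_ae_iff_prob_eq_one T.measurableSet_range_boundary).2 T.walkLaw_boundary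
  filter_upwards [h] with x hx
  refine propext ⟨?_, fun h' => ?_⟩
  · rintro ⟨e', he', rfl⟩
    rw [sector_vertex] at he'
    exact fun j hj => T.vertex_eq_of_le he' j hj
  · refine ⟨⟨x, hx⟩, ?_, rfl⟩
    rw [sector_vertex]
    exact h' n le_rfl

/-! ### Harmonic functions -/

section Harmonic

variable (𝕜 : Type*) [RCLike 𝕜] (E : Type v) [AddCommGroup E] [Module 𝕜 E] [Module ℝ E]
  [IsScalarTower ℝ 𝕜 E]

/-- The vector space `H_Q(T, E)` of the harmonic functions `f : T → E`, that is,
`f x = ∑ q(x, y) f y`, where `y` runs through the children of `x`; as a subspace of the space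
`V → E` of all functions, it carries the topology of pointwise convergence. -/
def harmonic : Submodule 𝕜 (V → E) where
  carrier := {f | ∀ x, f x = ∑ y ∈ T.children x, T.q x y • f y}
  add_mem' {f g} hf hg x := by
    simp only [Pi.add_apply, smul_add, Finset.sum_add_distrib]
    rw [← hf x, ← hg x]
  zero_mem' x := by simp
  smul_mem' c f hf x := by
    have := IsScalarTower.to_smulCommClass (R := ℝ) (A := 𝕜) (M := E)
    simp only [Pi.smul_apply]
    rw [hf x, Finset.smul_sum]
    exact Finset.sum_congr rfl fun y _ => smul_comm _ _ _

end Harmonic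

variable {E : Type v} [MetricSpace E]

/-- The random variable `ω_n(f)`: its value at the geodesic `e` is the value of `f` at the vertex
of `e` at distance `n` from the reference vertex. -/
noncomputable def omega (n : ℕ) (f : V → E) : LZero T.boundaryMeasure E :=
  AEEqFun.mk (fun e => f (e.vertex n)) <| by
    let _ : MeasurableSpace V := ⊤
    have := T.countable
    exact ((StronglyMeasurable.of_discrete (f := f)).comp_measurable
      (T.measurable_vertex n)).aestronglyMeasurable

/-- The defining property of frequent universality: `ω_n(f)` visits every non-empty open subset
of `L⁰(∂T, E)` for a set of times `n` of positive lower density. -/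
def IsFrequentlyUniversal (f : V → E) : Prop :=
  ∀ W : Set (LZero T.boundaryMeasure E), IsOpen W → W.Nonempty →
    0 < lowerDensity {n | T.omega n f ∈ W}

/-- The set `U_FM(T, E)` of the frequently universal harmonic functions. -/
def freqUniversal (𝕜 : Type*) [RCLike 𝕜] (E : Type v) [MetricSpace E] [AddCommGroup E]
    [Module 𝕜 E] [Module ℝ E] [IsScalarTower ℝ 𝕜 E] : Set (T.harmonic 𝕜 E) :=
  {f | T.IsFrequentlyUniversal (f : V → E)}

end WeightedTree

/-! Harmonic functions are very flexible on such a tree. The weights of the at least two children of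
a vertex sum to one, so some "light" child has weight at most 1/2. Beyond any level N, values `φ`
may be prescribed at all non-light children; the value at the light child is then found by solving
the harmonic equation at its parent (`extension`). If `φ` is constant along the edges of L
consecutive levels, a value once attained persists, so missing it at the end requires L light steps
in a row. This has probability at most `2⁻¹ ^ L`, whatever happened before
(`boundaryMeasure_extension_ne_le`).

Functions of a single vertex are dense in `L⁰` (`exists_omega_mem`), and `V → E` is separable, so
the targets can be listed as `c j` read at level `m`. A schedule built from the ruler sequence
performs each of countably many tasks during windows of any given length, with positive lower
density (`exists_schedule`). Task `⟨k, ⟨j, m⟩⟩` prescribes `c j` to the k-th function and zero to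
all others. Hence near the end of a window a linear combination with coefficient `a k ≠ 0` is close
to `a k • c j` in probability (`dist_omega_sum_scheduled_le`); since `a k` is invertible, such
multiples still reach every non-empty open set. So the span of the scheduled functions is frequently
universal apart from zero. It is dense because the functions agree with members of a dense sequence
up to higher and higher levels. -/

/-! ### Sets of positive lower density and a schedule of recurring tasks -/

/-- A set of natural numbers which eventually contains the values of an injective function of at
most linear growth has positive lower density. -/
theorem lowerDensity_pos_of_linear_growth {A : Set ℕ} {g : ℕ → ℕ} (hg : Function.Injective g)
    {C k₀ : ℕ} (hC : ∀ k, g k ≤ C * (k + 1)) (hA : ∀ k, k₀ ≤ k → g k ∈ A) :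
    0 < lowerDensity A := by
  have hC0 : 0 < C := by
    rcases Nat.eq_zero_or_pos C with rfl | h
    · have h0 := hC 0
      have h1 := hC 1
      have := hg (show g 0 = g 1 by omega)
      omega
    · exact h
  have hfin : ∀ n, {m | m ∈ A ∧ m ≤ n}.Finite := fun n =>
    (Set.finite_Iic n).subset fun m hm => hm.2
  have hcount : ∀ n, n / C ≤ {m | m ∈ A ∧ m ≤ n}.ncard + k₀ := by
    intro n
    have hsub : ((Finset.Ico k₀ (n / C)).image g : Set ℕ) ⊆ {m | m ∈ A ∧ m ≤ n} := by
      intro m hm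
      simp only [Finset.coe_image, Set.mem_image, Finset.mem_coe, Finset.mem_Ico] at hm
      obtain ⟨k, ⟨h1, h2⟩, rfl⟩ := hm
      refine ⟨hA k h1, (hC k).trans ?_⟩
      calc C * (k + 1) ≤ C * (n / C) := Nat.mul_le_mul_left _ h2
        _ ≤ n := Nat.mul_div_le n C
    have := Set.ncard_le_ncard hsub (hfin n)
    rw [Set.ncard_coe_finset, Finset.card_image_of_injective _ hg, Nat.card_Ico] at this
    omega
  have hC' : (0 : ℝ) < C := by exact_mod_cast hC0
  -- About `n / C` values of `g` lie below `n`; half of this rate absorbs the loss of the first `k₀`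
  -- values once `n` is large.
  have hδ : (0 : ℝ) < 1 / (2 * C) := by positivity
  refine hδ.trans_le (le_liminf_of_le ?_ ?_)
  · refine IsBoundedUnder.isCoboundedUnder_ge ⟨1, ?_⟩
    rw [eventually_map]
    refine Eventually.of_forall fun n => ?_
    have h : {m | m ∈ A ∧ m ≤ n}.ncard ≤ n + 1 := by
      have := Set.ncard_le_ncard (s := {m | m ∈ A ∧ m ≤ n}) (t := (Finset.Iic n : Set ℕ))
        (fun m hm => by simpa using hm.2) (Finset.finite_toSet _)
      simpa [Set.ncard_coe_finset] using this
    refine (div_le_one (by positivity)).2 ?_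
    exact_mod_cast h
  · filter_upwards [eventually_ge_atTop (2 * C * (k₀ + 2))] with n hn
    have h1 : n < C * (n / C + 1) := Nat.lt_mul_div_succ n hC0
    have h2 := hcount n
    have h3 : C * (n / C + 1) ≤ C * ({m | m ∈ A ∧ m ≤ n}.ncard + k₀ + 1) :=
      Nat.mul_le_mul_left _ (by omega)
    generalize {m | m ∈ A ∧ m ≤ n}.ncard = c at *
    rw [div_le_div_iff₀ (by positivity) (by positivity), one_mul]
    have h4 : n + 1 ≤ c * (2 * C) := by nlinarith
    exact_mod_cast h4

/-- There is a sequence of tasks in which every task `t` is, for every length `L`, performed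
during all of the time interval `[n - L, n]` for a set of times `n` of positive lower density. -/
theorem exists_schedule : ∃ s : ℕ → ℕ, ∀ (t L N : ℕ) (A : Set ℕ),
    (∀ n, N ≤ n → (∀ m, n ≤ m + L → m ≤ n → s m = t) → n ∈ A) → 0 < lowerDensity A := by
  -- Time is cut into blocks `[B i, B (i + 1))`. Block `i` has length `v₂(i + 1) + 1`, so the
  -- lengths telescope to `v₂(i!) + i`, which is at most `2 * i` by Legendre's formula.
  let B : ℕ → ℕ := fun i => padicValNat 2 i.factorial + i
  have hBsucc : ∀ i, B (i + 1) = B i + padicValNat 2 (i + 1) + 1 := by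
    intro i
    simp only [B, Nat.factorial_succ]
    rw [padicValNat.mul (by omega) (Nat.factorial_ne_zero i)]
    omega
  have hBmono : StrictMono B := strictMono_nat_of_lt_succ fun i => by rw [hBsucc]; omega
  have hBle : ∀ i, B i ≤ 2 * i := by
    intro i
    have := sub_one_mul_padicValNat_factorial (p := 2) i
    simp only [B]
    omega
  let idx : ℕ → ℕ := fun n => Nat.findGreatest (fun i => B i ≤ n) n
  have hidx : ∀ i n, B i ≤ n → n < B (i + 1) → idx n = i := by
    intro i n h1 h2
    refine (Nat.findGreatest_eq_iff).2 ⟨(hBmono.le_apply).trans h1, fun _ => h1, ?_⟩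
    intro j hj _ h
    have := hBmono.monotone (show i + 1 ≤ j from hj)
    omega
  -- The task during block `i` is the first component of `v₂(i + 1)`.
  refine ⟨fun n => (Nat.unpair (padicValNat 2 (idx n + 1))).1, fun t L N A hA => ?_⟩
  -- Blocks with `v₂(i + 1) = u` perform `t` and last `u + 1 ≥ L + 1` steps. They are those with `i
  -- + 1 = 2 ^ u * (2 * k + 1)`, an arithmetic progression, and `g k` is the last time of such a
  -- block.
  let u := Nat.pair t L
  let g : ℕ → ℕ := fun k => B (2 ^ u * (2 * k + 1)) - 1
  have hpos : ∀ k, 1 ≤ 2 ^ u * (2 * k + 1) := fun k => Nat.mul_pos (by positivity) (by omega)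
  have hgm : StrictMono g := by
    intro k k' hk
    have h0 : 2 ^ u * (2 * k + 1) < 2 ^ u * (2 * k' + 1) := by gcongr
    have h1 := hBmono h0
    have h2 := hBmono.le_apply (x := 2 ^ u * (2 * k + 1))
    have h3 := hpos k
    simp only [g]
    omega
  refine lowerDensity_pos_of_linear_growth (g := g) (C := 4 * 2 ^ u) (k₀ := N) hgm.injective ?_ ?_
  · intro k
    calc g k ≤ B (2 ^ u * (2 * k + 1)) := Nat.sub_le _ _
      _ ≤ 2 * (2 ^ u * (2 * k + 1)) := hBle _
      _ ≤ 2 * (2 ^ u * (2 * k + 2)) := by gcongr; omega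
      _ = 4 * 2 ^ u * (k + 1) := by ring
  · intro k hk
    refine hA _ (hk.trans hgm.le_apply) fun m hm1 hm2 => ?_
    obtain ⟨i, hi⟩ : ∃ i, 2 ^ u * (2 * k + 1) = i + 1 := ⟨_, (Nat.sub_add_cancel (hpos k)).symm⟩
    have hv : padicValNat 2 (i + 1) = u := by
      rw [← hi, padicValNat.mul (by positivity) (by omega), padicValNat.prime_pow,
        padicValNat.eq_zero_of_not_dvd (by omega), add_zero]
    have hs := hBsucc i
    have hL : L ≤ u := Nat.right_le_pair t L
    simp only [g, hi] at hm1 hm2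
    have : idx m = i := hidx i m (by omega) (by omega)
    simp only [this, hv, u, Nat.unpair_pair]

namespace WeightedTree

variable {V : Type u} (T : WeightedTree V)

/-! ### Levels, parents and ancestors -/

/-- The level of a vertex: its distance from the reference vertex. -/
noncomputable def level (x : V) : ℕ := T.graph.dist T.root x

theorem level_of_mem_children {x y : V} (h : y ∈ T.children x) : T.level y = T.level x + 1 :=
  (T.mem_children.1 h).2

theorem level_vertex (e : T.Boundary) (n : ℕ) : T.level (e.vertex n) = n :=
  T.dist_vertex e n

theorem vertex_succ_mem_children (e : T.Boundary) (n : ℕ) :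
    e.vertex (n + 1) ∈ T.children (e.vertex n) :=
  e.2.2 n

open Classical in
/-- The parent of a vertex (the vertex itself if it has none). -/
noncomputable def parent (y : V) : V := if h : ∃ x, y ∈ T.children x then h.choose else y

theorem parent_eq {x y : V} (h : y ∈ T.children x) : T.parent y = x := by
  have h' : ∃ x, y ∈ T.children x := ⟨x, h⟩
  rw [parent, dif_pos h']
  exact childrenSet_parent_unique T.isTree (T.mem_children.1 h'.choose_spec) (T.mem_children.1 h)

/-- The ancestor of a vertex `x` at level `m`, for `m` at most the level of `x`. -/
noncomputable def ancestor (m : ℕ) (x : V) : V := T.parent^[T.level x - m] x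

theorem ancestor_of_mem_children {m : ℕ} {x y : V} (hm : m ≤ T.level x) (h : y ∈ T.children x) :
    T.ancestor m y = T.ancestor m x := by
  rw [ancestor, ancestor, T.level_of_mem_children h, Nat.sub_add_comm hm,
    Function.iterate_succ_apply, T.parent_eq h]

theorem ancestor_vertex (e : T.Boundary) {m n : ℕ} (h : m ≤ n) :
    T.ancestor m (e.vertex n) = e.vertex m := by
  induction n, h using Nat.le_induction with
  | base => simp [ancestor, T.level_vertex]
  | succ n hn ih =>
    rw [T.ancestor_of_mem_children (by rwa [T.level_vertex]) (T.vertex_succ_mem_children e n), ih]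

/-- Two distinct children cannot both have weight above 1/2, as the total is one. The bound is
uniform in `x` although the weights may come arbitrarily close to 0 and 1. -/
theorem exists_light_child (x : V) : ∃ y ∈ T.children x, T.q x y ≤ 1 / 2 := by
  have hc : 1 < (T.children x).card := by
    have := T.two_le_children x
    rwa [Set.ncard_eq_toFinset_card _ (T.finite_childrenSet x)] at this
  obtain ⟨y, hy, z, hz, hyz⟩ := Finset.one_lt_card.1 hc
  by_contra! h
  have h1 := h y hy
  have h2 := h z hz
  have h3 : T.q x y + T.q x z ≤ ∑ w ∈ T.children x, T.q x w := by
    classical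
    rw [← Finset.sum_pair hyz]
    refine Finset.sum_le_sum_of_subset_of_nonneg ?_ fun w hw _ => (T.q_pos' hw).le
    intro w hw
    rcases Finset.mem_insert.1 hw with rfl | hw
    · exact hy
    · rwa [Finset.mem_singleton.1 hw]
  rw [T.sum_children_q] at h3
  linarith

/-- A child of `x` to which the walk moves from `x` with probability at most `1 / 2`. -/
noncomputable def lightChild (x : V) : V := (T.exists_light_child x).choose

theorem lightChild_mem (x : V) : T.lightChild x ∈ T.children x :=
  (T.exists_light_child x).choose_spec.1

theorem q_lightChild_le (x : V) : T.q x (T.lightChild x) ≤ 1 / 2 :=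
  (T.exists_light_child x).choose_spec.2

/-! ### Harmonic extensions with prescribed values off the light children -/

section Extension

variable {E : Type v} [AddCommGroup E] [Module ℝ E]

open Classical in
/-- The values at level `n` of the harmonic function which agrees with `g` up to level `N`, and
beyond that level agrees with `φ` at all vertices which are not light children. -/
noncomputable def extensionAux (g φ : V → E) (N : ℕ) : ℕ → V → E
  | 0, y => g y
  | n + 1, y =>
    if n + 1 ≤ N then g y
    else if y = T.lightChild (T.parent y) then
      (T.q (T.parent y) y)⁻¹ • (extensionAux g φ N n (T.parent y) -
        ∑ z ∈ (T.children (T.parent y)).erase y, T.q (T.parent y) z • φ z)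
    else φ y

/-- The harmonic function which agrees with `g` up to level `N`, and beyond that level agrees
with `φ` at all vertices which are not light children. -/
noncomputable def extension (g φ : V → E) (N : ℕ) (x : V) : E :=
  T.extensionAux g φ N (T.level x) x

theorem extension_of_level_le (g φ : V → E) {N : ℕ} {x : V} (h : T.level x ≤ N) :
    T.extension g φ N x = g x := by
  unfold extension
  cases hn : T.level x with
  | zero => rfl
  | succ n => rw [extensionAux, if_pos (hn ▸ h)]

theorem extension_of_ne_lightChild (g φ : V → E) {N : ℕ} {x y : V} (hN : N ≤ T.level x)
    (hy : y ∈ T.children x) (hne : y ≠ T.lightChild x) : T.extension g φ N y = φ y := by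
  rw [extension, T.level_of_mem_children hy, extensionAux, if_neg (by omega), T.parent_eq hy,
    if_neg hne]

open Classical in
theorem extension_lightChild (g φ : V → E) {N : ℕ} {x : V} (hN : N ≤ T.level x) :
    T.extension g φ N (T.lightChild x) = (T.q x (T.lightChild x))⁻¹ •
      (T.extension g φ N x -
        ∑ z ∈ (T.children x).erase (T.lightChild x), T.q x z • φ z) := by
  have hy := T.lightChild_mem x
  rw [extension, T.level_of_mem_children hy, extensionAux, if_neg (by omega), T.parent_eq hy,
    if_pos rfl]
  rfl

/-- Below level `N` the equation is inherited from `g`; from level `N` on, the value at the light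
child was chosen to solve it, its weight being positive. -/
theorem extension_mem_harmonic (𝕜 : Type*) [RCLike 𝕜] [Module 𝕜 E] [IsScalarTower ℝ 𝕜 E]
    {g : V → E} (hg : g ∈ T.harmonic 𝕜 E) (φ : V → E) (N : ℕ) :
    T.extension g φ N ∈ T.harmonic 𝕜 E := by
  classical
  intro x
  rcases Nat.lt_or_ge (T.level x) N with h | h
  · rw [T.extension_of_level_le g φ h.le, hg x]
    refine Finset.sum_congr rfl fun y hy => ?_
    rw [T.extension_of_level_le g φ (by rw [T.level_of_mem_children hy]; omega)]
  · have hs : ∑ y ∈ (T.children x).erase (T.lightChild x), T.q x y • T.extension g φ N y =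
        ∑ y ∈ (T.children x).erase (T.lightChild x), T.q x y • φ y :=
      Finset.sum_congr rfl fun y hy => by
        rw [T.extension_of_ne_lightChild g φ h (Finset.mem_of_mem_erase hy)
          (Finset.ne_of_mem_erase hy)]
    rw [← Finset.add_sum_erase _ _ (T.lightChild_mem x), T.extension_lightChild g φ h, smul_smul,
      mul_inv_cancel₀ (T.q_pos' (T.lightChild_mem x)).ne', one_smul, hs, sub_add_cancel]

/-- If the prescribed values do not change from `x` to its children, and are attained at `x`, then
they are attained at the children of `x`. -/
theorem extension_eq_of_eq (g φ : V → E) {N : ℕ} {x y : V} (hN : N ≤ T.level x)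
    (hy : y ∈ T.children x) (hφ : ∀ z ∈ T.children x, φ z = φ x)
    (hx : T.extension g φ N x = φ x) : T.extension g φ N y = φ y := by
  classical
  by_cases hne : y = T.lightChild x
  · have hq := T.sum_children_q x
    rw [← Finset.add_sum_erase _ _ hy] at hq
    have hs : ∑ z ∈ (T.children x).erase y, T.q x z • φ z = (1 - T.q x y) • φ x := by
      rw [← hq, add_sub_cancel_left, Finset.sum_smul]
      exact Finset.sum_congr rfl fun z hz => by rw [hφ z (Finset.mem_of_mem_erase hz)]
    subst hne
    rw [T.extension_lightChild g φ hN, hs, hx, hφ _ hy, sub_smul, one_smul, sub_sub_cancel,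
      smul_smul, inv_mul_cancel₀ (T.q_pos' hy).ne', one_smul]
  · exact T.extension_of_ne_lightChild g φ hN hy hne

end Extension

/-! ### The probability of missing the prescribed values -/

theorem measurableSet_vertex_mem (m : ℕ) (D : Set V) :
    MeasurableSet {e : T.Boundary | e.vertex m ∈ D} := by
  let _ : MeasurableSpace V := ⊤
  exact T.measurable_vertex m (MeasurableSet.of_discrete (s := D))

/-- Markov property: given the vertex at level `m`, the next step is light with conditional
probability at most 1/2. This is checked vertex by vertex and summed over `D`. -/
theorem boundaryMeasure_lightChild_le (m : ℕ) (D : Set V) :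
    T.boundaryMeasure {e | e.vertex m ∈ D ∧ e.vertex (m + 1) = T.lightChild (e.vertex m)} ≤
      2⁻¹ * T.boundaryMeasure {e | e.vertex m ∈ D} := by
  have := T.countable
  have hfiber (x : V) : T.boundaryMeasure
      {e | e.vertex m = x ∧ e.vertex (m + 1) = T.lightChild x} ≤
      2⁻¹ * T.boundaryMeasure {e | e.vertex m = x} := by
    rcases Set.eq_empty_or_nonempty
      {e : T.Boundary | e.vertex m = x ∧ e.vertex (m + 1) = T.lightChild x} with h | ⟨e, rfl, he⟩
    · rw [h, measure_empty]
      exact zero_le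
    · calc _ ≤ T.boundaryMeasure (T.sector (e.vertex (m + 1))) := by
            refine measure_mono fun e' he' => ?_
            rw [sector_vertex, he]
            exact he'.2
        _ = ENNReal.ofReal (T.q (e.vertex m) (e.vertex (m + 1))) *
            T.boundaryMeasure (T.sector (e.vertex m)) := by
            rw [boundaryMeasure_sector, boundaryMeasure_sector, Finset.prod_range_succ, mul_comm]
        _ ≤ 2⁻¹ * T.boundaryMeasure (T.sector (e.vertex m)) := by
            gcongr
            rw [he]
            calc ENNReal.ofReal (T.q (e.vertex m) (T.lightChild (e.vertex m)))
                ≤ ENNReal.ofReal (1 / 2) := ENNReal.ofReal_le_ofReal (T.q_lightChild_le _)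
              _ = 2⁻¹ := by
                rw [one_div, ENNReal.ofReal_inv_of_pos two_pos, ENNReal.ofReal_ofNat]
        _ = 2⁻¹ * T.boundaryMeasure {e' | e'.vertex m = e.vertex m} := by rw [sector_vertex]
  have hD : {e : T.Boundary | e.vertex m ∈ D} = ⋃ x ∈ D, {e | e.vertex m = x} := by
    ext e; simp
  have hD' : {e : T.Boundary | e.vertex m ∈ D ∧
      e.vertex (m + 1) = T.lightChild (e.vertex m)} =
      ⋃ x ∈ D, {e | e.vertex m = x ∧ e.vertex (m + 1) = T.lightChild x} := by
    ext e; simp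
  rw [hD, hD', measure_biUnion (f := fun x => {e : T.Boundary | e.vertex m = x}) D.to_countable
    (fun x _ x' _ hne => Set.disjoint_left.2 fun e h h' => hne (h.symm.trans h'))
    (fun x _ => T.measurableSet_vertex_mem m {x}), ← ENNReal.tsum_mul_left]
  exact (measure_biUnion_le _ D.to_countable _).trans (ENNReal.tsum_le_tsum fun x => hfiber x)

/-- If the prescribed values are constant along the edges between the levels `n` and `n + L`, then
they are attained at level `n + L` off a set of probability at most `2⁻ᴸ`. -/
theorem boundaryMeasure_extension_ne_le {E : Type v} [AddCommGroup E] [Module ℝ E]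
    (g φ : V → E) {N n : ℕ} (hN : N ≤ n) (L : ℕ)
    (hφ : ∀ x, n ≤ T.level x → T.level x < n + L → ∀ y ∈ T.children x, φ y = φ x) :
    T.boundaryMeasure
      {e | T.extension g φ N (e.vertex (n + L)) ≠ φ (e.vertex (n + L))} ≤ 2⁻¹ ^ L := by
  induction L with
  | zero => simpa using prob_le_one
  | succ L ih =>
    -- A miss at the next level forces a miss at the present one, since attained values persist, and
    -- also a light step, since all other children receive their prescribed value.
    calc _ ≤ T.boundaryMeasure {e | e.vertex (n + L) ∈ {x | T.extension g φ N x ≠ φ x} ∧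
            e.vertex (n + L + 1) = T.lightChild (e.vertex (n + L))} := by
          refine measure_mono fun e he => ?_
          have hc := T.vertex_succ_mem_children e (n + L)
          have hl := T.level_vertex e (n + L)
          refine ⟨fun h => he ?_, ?_⟩
          · exact T.extension_eq_of_eq g φ (by omega) hc
              (hφ _ (by omega) (by omega)) h
          · by_contra hne
            exact he (T.extension_of_ne_lightChild g φ (by omega) hc hne)
      _ ≤ 2⁻¹ * T.boundaryMeasure {e | e.vertex (n + L) ∈ {x | T.extension g φ N x ≠ φ x}} :=
          T.boundaryMeasure_lightChild_le _ _
      _ ≤ 2⁻¹ * 2⁻¹ ^ L := by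
          gcongr
          exact ih fun x h1 h2 => hφ x h1 (by omega)
      _ = 2⁻¹ ^ (L + 1) := by rw [pow_succ, mul_comm]

end WeightedTree

namespace LZero

/-! ### Convergence in probability -/

variable {Ω : Type u} [MeasurableSpace Ω] {P : Measure Ω} {E : Type v} [MetricSpace E]

/-- The class of a measurable function in `L⁰`. -/
def mk (f : Ω → E) (hf : AEStronglyMeasurable f P) : LZero P E := AEEqFun.mk f hf

theorem exists_eq_mk (h : LZero P E) :
    ∃ (f : Ω → E) (hf : StronglyMeasurable f), h = mk f hf.aestronglyMeasurable :=
  ⟨AEEqFun.cast h, AEEqFun.stronglyMeasurable _, (AEEqFun.mk_coeFn (μ := P) h).symm⟩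

variable [IsFiniteMeasure P]

theorem dist_mk {f g : Ω → E} (hf : AEStronglyMeasurable f P) (hg : AEStronglyMeasurable g P) :
    dist (mk f hf) (mk g hg) = ∫ x, dist (f x) (g x) / (1 + dist (f x) (g x)) ∂P := by
  refine integral_congr_ae ?_
  filter_upwards [AEEqFun.coeFn_mk f hf, AEEqFun.coeFn_mk g hg] with x h1 h2
  simp only [mk, h1, h2]

theorem integrable_dist_div {f g : Ω → E} (hf : AEStronglyMeasurable f P)
    (hg : AEStronglyMeasurable g P) :
    Integrable (fun x => dist (f x) (g x) / (1 + dist (f x) (g x))) P := by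
  refine (integrable_rho (AEEqFun.mk f hf) (AEEqFun.mk g hg)).congr ?_
  filter_upwards [AEEqFun.coeFn_mk f hf, AEEqFun.coeFn_mk g hg] with x h1 h2
  simp only [h1, h2]

theorem dist_div_le_one (a b : E) : dist a b / (1 + dist a b) ≤ 1 := by
  rw [div_le_one (by positivity)]
  linarith

/-- The integrand is at most one and vanishes where the functions agree. The set `s` need not be
measurable, hence the measurable hull in the proof. -/
theorem dist_mk_le {f g : Ω → E} (hf : AEStronglyMeasurable f P) (hg : AEStronglyMeasurable g P)
    {s : Set Ω} (hs : ∀ x, f x ≠ g x → x ∈ s) : dist (mk f hf) (mk g hg) ≤ P.real s := by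
  rw [dist_mk, measureReal_def, ← measure_toMeasurable s, ← measureReal_def,
    ← integral_indicator_one (measurableSet_toMeasurable P s)]
  refine integral_mono (integrable_dist_div hf hg)
    ((integrable_const 1).indicator (measurableSet_toMeasurable P s)) fun x => ?_
  by_cases hx : x ∈ toMeasurable P s
  · simpa [hx] using dist_div_le_one (f x) (g x)
  · have : f x = g x := by
      by_contra h
      exact hx (subset_toMeasurable P s (hs x h))
    simp [this, hx]

theorem tendsto_mk {F : ℕ → Ω → E} {f : Ω → E} (hF : ∀ n, AEStronglyMeasurable (F n) P)
    (hf : AEStronglyMeasurable f P) (h : ∀ x, Tendsto (fun n => F n x) atTop (𝓝 (f x))) :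
    Tendsto (fun n => mk (F n) (hF n)) atTop (𝓝 (mk f hf)) := by
  rw [tendsto_iff_dist_tendsto_zero]
  simp only [dist_mk]
  rw [← integral_zero Ω ℝ (μ := P)]
  refine tendsto_integral_of_dominated_convergence (fun _ => 1)
    (fun n => (integrable_dist_div (hF n) hf).aestronglyMeasurable) (integrable_const 1)
    (fun n => Eventually.of_forall fun x => ?_) (Eventually.of_forall fun x => ?_)
  · rw [Real.norm_of_nonneg (by positivity)]
    exact dist_div_le_one _ _
  · have h0 := tendsto_iff_dist_tendsto_zero.1 (h x)
    have h1 := h0.div (h0.const_add 1) (by norm_num)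
    rw [add_zero, zero_div] at h1
    exact h1

theorem dist_mk_add_le [AddCommGroup E] [ContinuousAdd E]
    (hdist : ∀ x y z : E, dist (x + z) (y + z) = dist x y) {f f' g g' : Ω → E}
    (hf : AEStronglyMeasurable f P) (hf' : AEStronglyMeasurable f' P)
    (hg : AEStronglyMeasurable g P) (hg' : AEStronglyMeasurable g' P) :
    dist (mk (f + g) (hf.add hg)) (mk (f' + g') (hf'.add hg')) ≤
      dist (mk f hf) (mk f' hf') + dist (mk g hg) (mk g' hg') := by
  refine (dist_triangle _ (mk (f' + g) (hf'.add hg)) _).trans (le_of_eq ?_)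
  have h : ∀ x y z : E, dist (z + x) (z + y) = dist x y := fun x y z => by
    rw [add_comm z, add_comm z, hdist]
  simp only [dist_mk, Pi.add_apply, hdist, h]

end LZero

namespace WeightedTree

variable {V : Type u} (T : WeightedTree V)

/-! ### Density in `L⁰` of the functions of a single vertex -/

section Approximation

variable {E : Type v} [MetricSpace E]

theorem stronglyMeasurable_comp_vertex (n : ℕ) (f : V → E) :
    StronglyMeasurable fun e : T.Boundary => f (e.vertex n) := by
  let _ : MeasurableSpace V := ⊤
  have := T.countable
  exact (StronglyMeasurable.of_discrete (f := f)).comp_measurable (T.measurable_vertex n)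

theorem omega_eq_mk (n : ℕ) (f : V → E) :
    T.omega n f = LZero.mk _ (T.stronglyMeasurable_comp_vertex n f).aestronglyMeasurable :=
  rfl

/-- As `V` is countable, `V → E` is first countable and sequences suffice; pointwise convergence
then gives convergence in probability. -/
theorem continuous_omega (n : ℕ) : Continuous (T.omega n : (V → E) → LZero _ E) := by
  have := T.countable
  refine continuous_iff_seqContinuous.2 fun F f hF => ?_
  exact LZero.tendsto_mk (fun k => (T.stronglyMeasurable_comp_vertex n (F k)).aestronglyMeasurable)
    (T.stronglyMeasurable_comp_vertex n f).aestronglyMeasurable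
    fun e => tendsto_pi_nhds.1 hF (e.vertex n)

theorem omega_ancestor {m n : ℕ} (h : m ≤ n) (f : V → E) :
    T.omega n (fun x => f (T.ancestor m x)) = T.omega m f := by
  refine AEEqFun.mk_eq_mk.2 (Eventually.of_forall fun e => ?_)
  simp only [T.ancestor_vertex e h]

/-- The sets of boundary points that are described by one of their vertices. -/
def cylinders : Set (Set T.Boundary) :=
  {A | ∃ (m : ℕ) (D : Set V), A = {e | e.vertex m ∈ D}}

theorem isSetAlgebra_cylinders : IsSetAlgebra T.cylinders where
  empty_mem := ⟨0, ∅, by simp⟩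
  compl_mem := by
    rintro _ ⟨m, D, rfl⟩
    exact ⟨m, Dᶜ, rfl⟩
  union_mem := by
    rintro _ _ ⟨m, D, rfl⟩ ⟨m', D', rfl⟩
    refine ⟨max m m', T.ancestor m ⁻¹' D ∪ T.ancestor m' ⁻¹' D', ?_⟩
    ext e
    simp [T.ancestor_vertex e (le_max_left m m'), T.ancestor_vertex e (le_max_right m m')]

theorem generateFrom_cylinders :
    (inferInstance : MeasurableSpace T.Boundary) = MeasurableSpace.generateFrom T.cylinders := by
  refine le_antisymm (MeasurableSpace.generateFrom_le ?_) (MeasurableSpace.generateFrom_le ?_)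
  · rintro _ ⟨x, rfl⟩
    refine MeasurableSpace.measurableSet_generateFrom ⟨T.level x, {x}, ?_⟩
    ext e
    refine ⟨?_, fun h => ⟨_, h⟩⟩
    rintro ⟨n, rfl⟩
    simp [T.level_vertex]
  · rintro _ ⟨m, D, rfl⟩
    exact T.measurableSet_vertex_mem m D

theorem measureDense_cylinders : T.boundaryMeasure.MeasureDense T.cylinders :=
  .of_generateFrom_isSetAlgebra_finite _ T.isSetAlgebra_cylinders T.generateFrom_cylinders

/-- A measurable set is approximated in measure by cylinders, which settles one-step functions; for
sums, both approximants are lifted to a common level through `omega_ancestor`. -/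
theorem simpleFunc_mem_closure [AddCommGroup E] [ContinuousAdd E]
    (hdist : ∀ x y z : E, dist (x + z) (y + z) = dist x y) (f : SimpleFunc T.Boundary E) :
    LZero.mk f f.stronglyMeasurable.aestronglyMeasurable ∈
      closure (⋃ m, Set.range (T.omega m : (V → E) → LZero _ E)) := by
  classical
  refine SimpleFunc.induction (motive := fun f : SimpleFunc T.Boundary E =>
    LZero.mk f f.stronglyMeasurable.aestronglyMeasurable ∈
      closure (⋃ m, Set.range (T.omega m : (V → E) → LZero _ E))) ?_ ?_ f
  · intro c s hs
    refine Metric.mem_closure_iff.2 fun ε hε => ?_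
    obtain ⟨_, ⟨m, D, rfl⟩, hD⟩ :=
      T.measureDense_cylinders.approx s hs (measure_ne_top _ _) ε hε
    refine ⟨_, Set.mem_iUnion.2 ⟨m, ⟨fun x => if x ∈ D then c else 0, rfl⟩⟩, ?_⟩
    rw [omega_eq_mk]
    refine (LZero.dist_mk_le _ _ (s := symmDiff s {e | e.vertex m ∈ D}) ?_).trans_lt ?_
    · intro e he
      by_contra h
      rw [Set.mem_symmDiff] at h
      refine he ?_
      by_cases h1 : e ∈ s <;> by_cases h2 : e.vertex m ∈ D <;> simp_all
    · exact (ENNReal.lt_ofReal_iff_toReal_lt (measure_ne_top _ _)).1 hD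
  · intro f g _ hf hg
    refine Metric.mem_closure_iff.2 fun ε hε => ?_
    obtain ⟨_, hf1, hf2⟩ := Metric.mem_closure_iff.1 hf (ε / 2) (half_pos hε)
    obtain ⟨_, hg1, hg2⟩ := Metric.mem_closure_iff.1 hg (ε / 2) (half_pos hε)
    obtain ⟨m, f', rfl⟩ := Set.mem_iUnion.1 hf1
    obtain ⟨n, g', rfl⟩ := Set.mem_iUnion.1 hg1
    rw [← T.omega_ancestor (le_max_left m n), omega_eq_mk] at hf2
    rw [← T.omega_ancestor (le_max_right m n), omega_eq_mk] at hg2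
    refine ⟨_, Set.mem_iUnion.2 ⟨max m n,
      ⟨fun x => f' (T.ancestor m x) + g' (T.ancestor n x), rfl⟩⟩, ?_⟩
    exact (LZero.dist_mk_add_le hdist _ _ _ _).trans_lt (by linarith)

/-- The functions of finitely many vertices are dense in `L⁰`. -/
theorem exists_omega_mem [AddCommGroup E] [ContinuousAdd E]
    (hdist : ∀ x y z : E, dist (x + z) (y + z) = dist x y)
    {W : Set (LZero T.boundaryMeasure E)} (hW : IsOpen W) (hne : W.Nonempty) :
    ∃ (m : ℕ) (c : V → E), T.omega m c ∈ W := by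
  obtain ⟨h, hh⟩ := hne
  have hcl : h ∈ closure (⋃ m, Set.range (T.omega m : (V → E) → LZero _ E)) := by
    obtain ⟨f, hf, rfl⟩ := LZero.exists_eq_mk h
    refine isClosed_closure.mem_of_tendsto (LZero.tendsto_mk
      (fun n => (hf.approx n).stronglyMeasurable.aestronglyMeasurable)
      hf.aestronglyMeasurable hf.tendsto_approx)
      (Eventually.of_forall fun n => T.simpleFunc_mem_closure hdist _)
  obtain ⟨_, h1, h2⟩ := mem_closure_iff.1 hcl W hW hh
  obtain ⟨m, c, rfl⟩ := Set.mem_iUnion.1 h2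
  exact ⟨m, c, h1⟩

end Approximation

/-! ### A sequence of harmonic functions directed by a schedule -/

section Scheduled

variable {E : Type v} [AddCommGroup E]

/-- The values prescribed to the `i`-th function by the schedule `s`: the task
`⟨k, ⟨j, m⟩⟩` prescribes to the `k`-th function the values of `c j` at the ancestors at level `m`,
and to the other functions the value zero. -/
noncomputable def scheduledValue (c : ℕ → V → E) (s : ℕ → ℕ) (i : ℕ) (x : V) : E :=
  if (Nat.unpair (s (T.level x))).1 = i then
    c (Nat.unpair (Nat.unpair (s (T.level x))).2).1
      (T.ancestor (Nat.unpair (Nat.unpair (s (T.level x))).2).2 x)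
  else 0

theorem scheduledValue_of_task (c : ℕ → V → E) {s : ℕ → ℕ} (i : ℕ) {k j m : ℕ} {x : V}
    (hs : s (T.level x) = Nat.pair k (Nat.pair j m)) :
    T.scheduledValue c s i x = if k = i then c j (T.ancestor m x) else 0 := by
  simp only [scheduledValue, hs, Nat.unpair_pair]

/-- A vertex and its child share their ancestor at level `m`, so during a task the prescribed values
are constant along edges, as `boundaryMeasure_extension_ne_le` requires. -/
theorem scheduledValue_of_mem_children (c : ℕ → V → E) {s : ℕ → ℕ} (i : ℕ) {k j m : ℕ} {x y : V}
    (hs : s (T.level x) = Nat.pair k (Nat.pair j m))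
    (hs' : s (T.level x + 1) = Nat.pair k (Nat.pair j m)) (hm : m ≤ T.level x)
    (hy : y ∈ T.children x) : T.scheduledValue c s i y = T.scheduledValue c s i x := by
  rw [T.scheduledValue_of_task c i hs,
    T.scheduledValue_of_task c i (by rwa [T.level_of_mem_children hy]),
    T.ancestor_of_mem_children hm hy]

variable [Module ℝ E]

/-- The `i`-th function directed by the schedule: it agrees with `g i` up to level `i`, and it
attains the prescribed values at all later vertices which are not light children. -/
noncomputable def scheduled (g c : ℕ → V → E) (s : ℕ → ℕ) (i : ℕ) : V → E :=
  T.extension (g i) (T.scheduledValue c s i) i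

/-- While the schedule performs the task `⟨k, ⟨j, m⟩⟩`, a linear combination of the scheduled
functions approaches a multiple of `c j`. -/
theorem dist_omega_sum_scheduled_le [MetricSpace E] {𝕜 : Type*} [RCLike 𝕜] [Module 𝕜 E]
    (g c : ℕ → V → E) {s : ℕ → ℕ} {k j m n L : ℕ} (hm : m ≤ n) (a : ℕ →₀ 𝕜)
    (hk : k ∈ a.support) (ha : ∀ i ∈ a.support, i ≤ n)
    (hs : ∀ p, n ≤ p → p ≤ n + L → s p = Nat.pair k (Nat.pair j m)) :
    dist (T.omega (n + L) (a.sum fun i b => b • T.scheduled g c s i)) (T.omega m (a k • c j)) ≤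
      a.support.card * 2⁻¹ ^ L := by
  let B : ℕ → Set T.Boundary := fun i => {e | T.scheduled g c s i (e.vertex (n + L)) ≠
    T.scheduledValue c s i (e.vertex (n + L))}
  have hB : ∀ i ∈ a.support, T.boundaryMeasure.real (B i) ≤ 2⁻¹ ^ L := by
    intro i hi
    have h := T.boundaryMeasure_extension_ne_le (g i) (T.scheduledValue c s i) (ha i hi) L
      fun x h1 h2 y hy => T.scheduledValue_of_mem_children c i (hs _ h1 h2.le)
        (hs _ (by omega) (by omega)) (hm.trans h1) hy
    have h' := ENNReal.toReal_mono (by simp) h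
    rw [ENNReal.toReal_pow, ENNReal.toReal_inv, ENNReal.toReal_ofNat] at h'
    exact h'
  have hval : ∀ e : T.Boundary, ∀ i, T.scheduledValue c s i (e.vertex (n + L)) =
      if k = i then c j (e.vertex m) else 0 := by
    intro e i
    rw [T.scheduledValue_of_task c i (hs _ (by rw [level_vertex]; omega) (by rw [level_vertex])),
      T.ancestor_vertex e (by omega)]
  rw [omega_eq_mk, omega_eq_mk]
  refine (LZero.dist_mk_le _ _ (s := ⋃ i ∈ a.support, B i) ?_).trans ?_
  -- Off the exceptional sets every summand takes its prescribed value, and only the `k`-th of these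
  -- can be non-zero.
  · intro e he
    by_contra hne
    simp only [B, Set.mem_iUnion, not_exists, Set.mem_ofPred_eq, not_not] at hne
    refine he ?_
    simp only [Finsupp.sum, Finset.sum_apply, Pi.smul_apply]
    rw [Finset.sum_congr rfl fun i hi => by rw [hne i hi, hval e i]]
    simp only [smul_ite, smul_zero]
    rw [Finset.sum_ite_eq, if_pos hk]
  · calc T.boundaryMeasure.real (⋃ i ∈ a.support, B i)
        ≤ ∑ i ∈ a.support, T.boundaryMeasure.real (B i) := measureReal_biUnion_finset_le _ _
      _ ≤ a.support.card * 2⁻¹ ^ L := by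
        rw [← nsmul_eq_mul]
        exact Finset.sum_le_card_nsmul _ _ _ hB

/-- If `c` is dense and the schedule performs all tasks frequently, then the non-trivial linear
combinations of the scheduled functions are frequently universal. -/
theorem isFrequentlyUniversal_sum_scheduled [MetricSpace E] [IsTopologicalAddGroup E]
    {𝕜 : Type*} [RCLike 𝕜] [Module 𝕜 E] [ContinuousSMul 𝕜 E]
    (hdist : ∀ x y z : E, dist (x + z) (y + z) = dist x y) (g : ℕ → V → E) {c : ℕ → V → E}
    (hc : DenseRange c) {s : ℕ → ℕ}
    (hs : ∀ (t L N : ℕ) (A : Set ℕ),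
      (∀ n, N ≤ n → (∀ m, n ≤ m + L → m ≤ n → s m = t) → n ∈ A) → 0 < lowerDensity A)
    {a : ℕ →₀ 𝕜} (ha : a ≠ 0) :
    T.IsFrequentlyUniversal (a.sum fun i b => b • T.scheduled g c s i) := by
  intro W hW hne
  obtain ⟨k, hk⟩ := Finsupp.support_nonempty_iff.2 ha
  obtain ⟨m, c', hc'⟩ := T.exists_omega_mem hdist hW hne
  -- The preimage of `W` under `x ↦ T.omega m (a k • x)` is open and contains `(a k)⁻¹ • c'`, so it
  -- contains some `c j`.
  obtain ⟨j, hj⟩ := hc.exists_mem_open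
    (hW.preimage ((T.continuous_omega m).comp (continuous_const_smul (a k))))
    ⟨(a k)⁻¹ • c', by
      simpa [smul_smul, mul_inv_cancel₀ (Finsupp.mem_support_iff.1 hk)] using hc'⟩
  obtain ⟨r, hr, hball⟩ := Metric.isOpen_iff.1 hW _ hj
  have hlim : Tendsto (fun L : ℕ => (a.support.card : ℝ) * 2⁻¹ ^ L) atTop (𝓝 0) := by
    simpa using (tendsto_pow_atTop_nhds_zero_of_lt_one (r := (2⁻¹ : ℝ)) (by norm_num)
      (by norm_num)).const_mul (a.support.card : ℝ)
  obtain ⟨L, hL⟩ := (hlim.eventually_lt_const hr).exists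
  -- The bound makes the start `n - L` of the window at least `m` and at least every level up to
  -- which a function in the combination still copies its `g i`.
  refine hs (Nat.pair k (Nat.pair j m)) L (max m (a.support.sup id) + L) _ fun n hn hsn => ?_
  obtain ⟨n, rfl⟩ := Nat.exists_eq_add_of_le' (show L ≤ n by omega)
  refine hball ((T.dist_omega_sum_scheduled_le g c (by omega) a hk (fun i hi => ?_)
    fun p h1 h2 => hsn p (by omega) h2).trans_lt hL)
  have := Finset.le_sup (f := id) hi
  simp only [id] at this
  omega

end Scheduled

/-! ### Density of the span, and the theorem -/

/-- The extensions of `g` from higher and higher levels converge to `g` pointwise. -/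
theorem tendsto_extension {E : Type v} [TopologicalSpace E] [AddCommGroup E] [Module ℝ E]
    (g : V → E) (φ : ℕ → V → E) {N : ℕ → ℕ} (hN : Tendsto N atTop atTop) :
    Tendsto (fun n => T.extension g (φ n) (N n)) atTop (𝓝 g) := by
  refine tendsto_pi_nhds.2 fun x => tendsto_const_nhds.congr' ?_
  filter_upwards [hN.eventually_ge_atTop (T.level x)] with n hn
  exact (T.extension_of_level_le g (φ n) hn).symm

end WeightedTree

/-- In the hypotheses, `E` is a separable Fréchet space over `𝕜`, where `𝕜` is `ℝ` or `ℂ`, with a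
complete translation-invariant metric that induces its topology. -/
theorem theorem4p3 {V : Type u} (T : WeightedTree V) (𝕜 : Type*) [RCLike 𝕜]
    (E : Type v) [AddCommGroup E] [Module 𝕜 E] [Module ℝ E] [IsScalarTower ℝ 𝕜 E]
    [MetricSpace E] [IsTopologicalAddGroup E] [ContinuousSMul 𝕜 E] [LocallyConvexSpace ℝ E]
    [CompleteSpace E] [TopologicalSpace.SeparableSpace E]
    (hdist : ∀ x y z : E, dist (x + z) (y + z) = dist x y) :
    ∃ L : Submodule 𝕜 (T.harmonic 𝕜 E),
      (L : Set (T.harmonic 𝕜 E)) ⊆ T.freqUniversal 𝕜 E ∪ {0} ∧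
        Dense (L : Set (T.harmonic 𝕜 E)) := by
  have := T.countable
  have : SecondCountableTopology E := UniformSpace.secondCountable_of_separable E
  have : SecondCountableTopology (T.harmonic 𝕜 E) :=
    TopologicalSpace.Subtype.secondCountableTopology _
  obtain ⟨s, hs⟩ := exists_schedule
  obtain ⟨c, hc⟩ := TopologicalSpace.exists_dense_seq (V → E)
  obtain ⟨g, hg⟩ := TopologicalSpace.exists_dense_seq (T.harmonic 𝕜 E)
  -- Each `g i` recurs at all indices `Nat.pair i n`, where it is copied up to level `Nat.pair i n ≥
  -- n`; hence `f (Nat.pair i n)` tends to `g i`.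
  let g' : ℕ → V → E := fun i => g (Nat.unpair i).1
  let f : ℕ → T.harmonic 𝕜 E := fun i => ⟨T.scheduled g' c s i,
    T.extension_mem_harmonic 𝕜 (g (Nat.unpair i).1).2 _ _⟩
  refine ⟨Submodule.span 𝕜 (Set.range f), fun v hv => ?_, ?_⟩
  · obtain ⟨a, rfl⟩ := Finsupp.mem_span_range_iff_exists_finsupp.1 hv
    by_cases ha : a = 0
    · right
      simp [ha]
    · left
      have h := T.isFrequentlyUniversal_sum_scheduled hdist g' hc hs ha
      have hcoe : ((a.sum fun i b => b • f i : T.harmonic 𝕜 E) : V → E) =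
          a.sum fun i b => b • T.scheduled g' c s i := by
        simp only [Finsupp.sum, f, Submodule.coe_sum, Submodule.coe_smul]
      rw [WeightedTree.freqUniversal, Set.mem_ofPred_eq, hcoe]
      exact h
  · refine Dense.mono Submodule.subset_span (dense_closure.1 (Dense.mono ?_ hg))
    rintro _ ⟨i, rfl⟩
    refine mem_closure_of_tendsto (f := fun n => f (Nat.pair i n)) (b := atTop) ?_
      (Eventually.of_forall fun n => ⟨_, rfl⟩)
    have h := T.tendsto_extension (g i : V → E) (fun n => T.scheduledValue c s (Nat.pair i n))
      (tendsto_atTop_mono (fun n => Nat.right_le_pair i n) tendsto_id)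
    refine tendsto_subtype_rng.2 (h.congr fun n => ?_)
    simp only [f, WeightedTree.scheduled, g', Nat.unpair_pair]
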